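/- Let $k\in\{1,\dots,6\}$, $T>0$ and $\beta_0>0$. Then there are $\kappa>0$ and $\gamma=\gamma(\kappa)\in(0,1)$, depending only on $k$, $T$, $\beta_0$ (in particular not on the step size $\tau$), such that the following holds. Let $V\subset H=H'\subset V'$ be a Gelfand triple of complex Hilbert spaces ($V\hookrightarrow H$ continuous and dense), let $A:V\to V'$ be bounded, linear and self-adjoint with $\beta_0\|u\|_V^2\le\langle Au,u\rangle\le\beta_1\|u\|_V^2$ for all $u\in V$, where $\beta_1>\beta_0$, let $v\in H$, let $f\in C^{\max(k-2,0)}([0,T];V')$, and let $N\ge1$, $\tau=T/N$, $t_n=n\tau$. Put $\sum_{j=0}^k\omega_j\zeta^j=\sum_{\ell=1}^k\frac1\ell(1-\zeta)^\ell$, $\bar\partial_\tau U^n=\frac1\tau\sum_{j=0}^k\omega_jU^{n-j}$ and $$\bar f_n=f(t_n)+a_n^{(k)}\,(f(0)-Av)+\sum_{\ell=1}^{k-2}b_{\ell,n}^{(k)}\tau^\ell\partial_t^\ell f(0),$$ where $a_n^{(k)}=b_{\ell,n}^{(k)}=0$ except for the following values. For $n=1,\dots,k-1$, * $k=2$: $a_n=\frac12$;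 * $k=3$: $a_n=\frac{11}{12},-\frac5{12}$; * $k=4$: $a_n=\frac{31}{24},-\frac76,\frac38$; * $k=5$: $a_n=\frac{1181}{720},-\frac{177}{80},\frac{341}{240},-\frac{251}{720}$; * $k=6$: $a_n=\frac{2837}{1440},-\frac{2543}{720},\frac{17}{5},-\frac{1201}{720},\frac{95}{288}$; and, for $n=1,2,\dots$ (later values being zero), * $k=3$: $b_{1,n}=\frac1{12}$; * $k=4$: $b_{1,n}=\frac16,-\frac1{12}$; * $k=5$: $b_{1,n}=\frac{59}{240},-\frac{29}{120},\frac{19}{240}$; $b_{2,n}=\frac1{240},-\frac1{240}$; $b_{3,n}=\frac1{720}$; * $k=6$: $b_{1,n}=\frac{77}{240},-\frac7{15},\frac{73}{240},-\frac3{40}$; $b_{2,n}=\frac1{96},-\frac1{60},\frac1{160}$; $b_{3,n}=-\frac1{360},\frac1{720}$. The BDF$k$ scheme is $$\bar\partial_\tau U^n+AU^n=\bar f_n\quad(1\le n\le N),\qquad U^{-(k-1)}=\dots=U^0=v,$$ and one step of the iteration computes $U_m$ from $U_{m-1}$ by $$\bar\partial_\tau U_m^n+AU_m^n=\bar f_n\quad(1\le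 n\le N),\qquad U_m^{-j}=v+\kappa\,(U_m^{N-j}-U_{m-1}^{N-j})\quad(0\le j\le k-1).$$ The $n$-th equation is required for $U^n\in H$ with $U^n+a_n^{(k)}v\in V$ and is read in $V'$ after collecting $AU^n+a_n^{(k)}Av=A(U^n+a_n^{(k)}v)$; if $v\in V$ this means $U^n\in V$ and the displayed equation in $V'$. The same reading applies to $U_m^n$. Then the BDF$k$ scheme has a unique solution, each step of the iteration has a unique solution for every given $U_{m-1}$ with values in $H$, and, for every initial guess $U_0$ with values in $H$, $$\sum_{j=0}^{k-1}\|U^{N-j}-U_m^{N-j}\|_H\le\gamma(\kappa)\sum_{j=0}^{k-1}\|U^{N-j}-U_{m-1}^{N-j}\|_H\qquad\text{for all } m\ge1.$$ -/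

import Mathlib

open scoped ComplexConjugate

noncomputable section

/-- The dual `V'` of a complex Hilbert space `V` in a Gelfand triple: the bounded conjugate-linear
functionals on `V`. For `g : V'` and `w : V`, the pairing `⟨g, w⟩` is `g w`. -/
abbrev AntiDual (V : Type*) [NormedAddCommGroup V] [InnerProductSpace ℂ V] : Type _ :=
  V →L⋆[ℂ] ℂ

/-- `ι` is the continuous, dense embedding `V ↪ H` of a Gelfand triple `V ⊂ H = H' ⊂ V'`.
An element `u : H` acts on `w : V` by `⟨u, w⟩ = inner ℂ (ι w) u`
(Mathlib's inner product is conjugate-linear in its first argument). -/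
structure IsGelfandEmbedding {H V : Type*} [NormedAddCommGroup H] [InnerProductSpace ℂ H]
    [NormedAddCommGroup V] [InnerProductSpace ℂ V] (ι : V →L[ℂ] H) : Prop where
  injective : Function.Injective ι
  denseRange : DenseRange ι

/-- `A : V → V'` is self-adjoint and `β₀ ‖u‖_V² ≤ ⟨A u, u⟩ ≤ β₁ ‖u‖_V²`
(the number `⟨A u, u⟩` is real by self-adjointness). -/
structure IsEllipticOperator {V : Type*} [NormedAddCommGroup V] [InnerProductSpace ℂ V]
    (A : V →L[ℂ] AntiDual V) (β₀ β₁ : ℝ) : Prop where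
  selfAdjoint : ∀ u w : V, A u w = conj (A w u)
  lower : ∀ u : V, β₀ * ‖u‖ ^ 2 ≤ (A u u).re
  upper : ∀ u : V, (A u u).re ≤ β₁ * ‖u‖ ^ 2

/-- The generating polynomial `δ_k(ζ) = ∑_{ℓ=1}^k (1 - ζ)^ℓ / ℓ` of the BDF`k` method. -/
def bdfPoly (k : ℕ) : Polynomial ℝ :=
  ∑ l ∈ Finset.Icc 1 k, Polynomial.C (1 / (l : ℝ)) * (1 - Polynomial.X) ^ l

/-- The BDF`k` weights `ω_j`, given by `δ_k(ζ) = ∑_{j=0}^k ω_j ζ^j`. -/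
def bdfWeight (k j : ℕ) : ℝ := (bdfPoly k).coeff j

/-- The starting corrections `a_n^{(k)}`, as a function of `k` and `n`; zero for `n ≥ k`. -/
def bdfA : ℕ → ℕ → ℝ
  | 2, 1 => 1 / 2
  | 3, 1 => 11 / 12
  | 3, 2 => -5 / 12
  | 4, 1 => 31 / 24
  | 4, 2 => -7 / 6
  | 4, 3 => 3 / 8
  | 5, 1 => 1181 / 720
  | 5, 2 => -177 / 80
  | 5, 3 => 341 / 240
  | 5, 4 => -251 / 720
  | 6, 1 => 2837 / 1440
  | 6, 2 => -2543 / 720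
  | 6, 3 => 17 / 5
  | 6, 4 => -1201 / 720
  | 6, 5 => 95 / 288
  | _, _ => 0

/-- The starting corrections `b_{ℓ,n}^{(k)}`, as a function of `k`, `ℓ` and `n`;
zero for `n ≥ k`. -/
def bdfB : ℕ → ℕ → ℕ → ℝ
  | 3, 1, 1 => 1 / 12
  | 4, 1, 1 => 1 / 6
  | 4, 1, 2 => -1 / 12
  | 5, 1, 1 => 59 / 240
  | 5, 1, 2 => -29 / 120
  | 5, 1, 3 => 19 / 240
  | 5, 2, 1 => 1 / 240
  | 5, 2, 2 => -1 / 240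
  | 5, 3, 1 => 1 / 720
  | 6, 1, 1 => 77 / 240
  | 6, 1, 2 => -7 / 15
  | 6, 1, 3 => 73 / 240
  | 6, 1, 4 => -3 / 40
  | 6, 2, 1 => 1 / 96
  | 6, 2, 2 => -1 / 60
  | 6, 2, 3 => 1 / 160
  | 6, 3, 1 => -1 / 360
  | 6, 3, 2 => 1 / 720
  | _, _, _ => 0

section Scheme

variable {H V : Type*} [NormedAddCommGroup H] [InnerProductSpace ℂ H]
  [NormedAddCommGroup V] [InnerProductSpace ℂ V]

/-- The BDF`k` difference quotient `(1/τ) ∑_{j=0}^k ω_j U^{n-j}`. -/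
def bdfDiff (k : ℕ) (τ : ℝ) (U : ℤ → H) (n : ℤ) : H :=
  (1 / τ) • ∑ j ∈ Finset.range (k + 1), bdfWeight k j • U (n - j)

/-- The part of the corrected source `f̄_n` that comes from `f`:
`f(t_n) + a_n f(0) + ∑_{ℓ=1}^{k-2} b_{ℓ,n} τ^ℓ ∂_t^ℓ f(0)`, with `τ = T / N` and `t_n = n τ`.
The remaining part of `f̄_n` is `- a_n A v`. -/
def bdfSource (k N : ℕ) (T : ℝ) (f : ℝ → AntiDual V) (n : ℕ) : AntiDual V :=
  f (n * (T / N)) + bdfA k n • f 0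
    + ∑ l ∈ Finset.Icc 1 (k - 2),
        (bdfB k l n * (T / N) ^ l) • iteratedDerivWithin l f (Set.Icc 0 T) 0

/-- `U` satisfies the corrected BDF`k` equation
`(1/τ) ∑_j ω_j U^{n-j} + A U^n = f(t_n) + a_n (f(0) - A v) + ∑_ℓ b_{ℓ,n} τ^ℓ ∂_t^ℓ f(0)`
at the time level `n`.
The two terms with `A` are collected as `A (U^n + a_n v)` with `U^n + a_n v ∈ V`, and the equation
is then one in `V'`. If `v ∈ V`, or if `a_n = 0`, then this says that `U^n ∈ V` and that the
displayed equation holds in `V'`. If `v` is only in `H`, then `A v` and `A U^n` need not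
be in `V'` separately, and this is the displayed equation read in the dual of the domain of `A`. -/
def BDFEquation (k N : ℕ) (T : ℝ) (ι : V →L[ℂ] H) (A : V →L[ℂ] AntiDual V)
    (f : ℝ → AntiDual V) (v : H) (U : ℤ → H) (n : ℕ) : Prop :=
  ∃ x : V, ι x = U n + bdfA k n • v ∧
    ∀ w : V, inner ℂ (ι w) (bdfDiff k (T / N) U n) + A x w = bdfSource k N T f n w

/-- `U^n`, `-(k-1) ≤ n ≤ N`, is the solution of the BDF`k` scheme with step `τ = T / N` and
starting values `U^{-(k-1)} = ⋯ = U^0 = v`. Values of `U` at other indices play no role. -/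
structure IsBDFSolution (k N : ℕ) (T : ℝ) (ι : V →L[ℂ] H) (A : V →L[ℂ] AntiDual V)
    (f : ℝ → AntiDual V) (v : H) (U : ℤ → H) : Prop where
  initial : ∀ j : ℕ, j < k → U (-(j : ℤ)) = v
  equation : ∀ n : ℕ, 1 ≤ n → n ≤ N → BDFEquation k N T ι A f v U n

/-- `U = U_m` is obtained from `Uprev = U_{m-1}` by one step of the parallel-in-time iteration:
the BDF`k` equations for `1 ≤ n ≤ N`, with the starting values
`U_m^{-j} = v + κ (U_m^{N-j} - U_{m-1}^{N-j})`, `0 ≤ j ≤ k-1`. -/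
structure IsBDFIterate (k N : ℕ) (T κ : ℝ) (ι : V →L[ℂ] H) (A : V →L[ℂ] AntiDual V)
    (f : ℝ → AntiDual V) (v : H) (Uprev U : ℤ → H) : Prop where
  initial : ∀ j : ℕ, j < k →
    U (-(j : ℤ)) = v + κ • (U ((N : ℤ) - j) - Uprev ((N : ℤ) - j))
  equation : ∀ n : ℕ, 1 ≤ n → n ≤ N → BDFEquation k N T ι A f v U n

end Scheme

end

noncomputable section

/-! Everything rests on stability (`exists_bdf_stability`): two solutions with the same data differ
by at most `K` times the sum of the differences of their `k` starting values, with `K` depending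
only on `k`. The iteration perturbs the starting values by `κ` times the error at the end, so for `κ
k K ≤ 1/4` a step contracts. No decay in time is used, so `κ` and `γ = 1/2` depend on `k` alone.

For stability, the difference satisfies `eⁿ = -R ∑_{j≥1} ω_j e^{n-j}` with `R = ι (ω₀ ι†ι + τA)⁻¹
ι†`, a nonnegative operator with `‖R‖ ≤ 1/ω₀`. Hence `eⁿ` is a sum of real polynomials in `R`
applied to the starting values, and the functional calculus reduces the claim to scalar recurrences
with `r ∈ [0, 1/ω₀]`, uniformly in `r`.

A characteristic root `a` of modulus at least `1` would satisfy `δ_k(1/a) = -(1 - rω₀)/r ≤ 0`. A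
multiplier `μ` with `Re μ > 0` and `Re (δ_k μ) > 0` on the closed disc without `1` excludes this
unless `a = 1` and `rω₀ = 1`, where the root is simple. By compactness, all roots but one lie in a
fixed disc of radius `ρ < 1`; factoring the shift polynomial then gives the uniform bound. -/

/-! ### The BDF symbol on the unit disc -/

theorem mul_pow_nonneg {a b c : ℝ} (ha : a ≤ c) (hb : c ≤ b) (i j : ℕ) :
    0 ≤ (c - a) ^ i * (b - c) ^ j :=
  mul_nonneg (pow_nonneg (sub_nonneg.2 ha) i) (pow_nonneg (sub_nonneg.2 hb) j)

/-- The Chebyshev recurrence: on the unit circle it turns real parts of polynomials in `ζ` into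
polynomials in `ζ.re`. -/
theorem Complex.re_pow_add_two_of_norm_eq_one {ζ : ℂ} (hζ : ‖ζ‖ = 1) (n : ℕ) :
    (ζ ^ (n + 2)).re = 2 * ζ.re * (ζ ^ (n + 1)).re - (ζ ^ n).re := by
  have h : ζ.re ^ 2 + ζ.im ^ 2 = 1 := by
    rw [← one_pow 2, ← hζ, Complex.sq_norm, Complex.normSq_apply]; ring
  simp only [pow_succ, Complex.mul_re, Complex.mul_im]
  linear_combination -(ζ ^ n).re * h

/-- On the unit circle, the multiplier `1 + 17/16 ζ + 11/16 ζ²` turns the BDF symbol into a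
function with positive real part. -/
theorem bdfSymbol_mul_re_pos {k : ℕ} (hk1 : 1 ≤ k) (hk6 : k ≤ 6) {ζ : ℂ} (hζ : ‖ζ‖ = 1)
    (hne : ζ ≠ 1) :
    0 < ((∑ l ∈ Finset.Icc 1 k, (1 / (l : ℂ)) * (1 - ζ) ^ l)
      * (1 + 17 / 16 * ζ + 11 / 16 * ζ ^ 2)).re := by
  have hc1 : ζ.re ≤ 1 := hζ ▸ Complex.re_le_norm ζ
  have hcm : -1 ≤ ζ.re := by
    have := (abs_le.1 (Complex.abs_re_le_norm ζ)).1
    rwa [hζ] at this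
  have hc : 0 < 1 - ζ.re := by
    refine sub_pos.2 (lt_of_le_of_ne hc1 fun h => hne ?_)
    have h2 : ζ.re ^ 2 + ζ.im ^ 2 = 1 := by
      rw [← one_pow 2, ← hζ, Complex.sq_norm, Complex.normSq_apply]; ring
    have h3 : ζ.im = 0 := by rw [h] at h2; simpa using h2
    exact Complex.ext (by simpa using h) (by simpa using h3)
  have hcases : (-1 ≤ ζ.re ∧ ζ.re ≤ -3 / 4) ∨ (-3 / 4 ≤ ζ.re ∧ ζ.re ≤ -1 / 2) ∨
      (-1 / 2 ≤ ζ.re ∧ ζ.re ≤ 0) ∨ (0 ≤ ζ.re ∧ ζ.re ≤ 1) := by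
    grind
  have h0 : (ζ ^ 0).re = 1 := by simp
  have h1 : (ζ ^ 1).re = ζ.re := by simp
  have h2 := Complex.re_pow_add_two_of_norm_eq_one hζ 0
  have h3 := Complex.re_pow_add_two_of_norm_eq_one hζ 1
  have h4 := Complex.re_pow_add_two_of_norm_eq_one hζ 2
  have h5 := Complex.re_pow_add_two_of_norm_eq_one hζ 3
  have h6 := Complex.re_pow_add_two_of_norm_eq_one hζ 4
  have h7 := Complex.re_pow_add_two_of_norm_eq_one hζ 5
  have h8 := Complex.re_pow_add_two_of_norm_eq_one hζ 6
  norm_num only at h2 h3 h4 h5 h6 h7 h8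
  interval_cases k
  · have expand : (∑ l ∈ Finset.Icc (1 : ℕ) 1, (1 / (l : ℂ)) * (1 - ζ) ^ l)
        * (1 + 17 / 16 * ζ + 11 / 16 * ζ ^ 2) =
          (1 : ℝ) • ζ ^ 0 + (1 / 16 : ℝ) • ζ ^ 1 + (-3 / 8 : ℝ) • ζ ^ 2 + (-11 / 16 : ℝ) •
          ζ ^ 3 := by
      simp [Complex.real_smul]; ring
    -- In each case the real part is `(1 - c) q(c)` with `c = ζ.re`. Positivity of `q` is certified
    -- on four subintervals `[a, b]` by the Bernstein products `(c - a)^i (b - c)^j`, `i + j = 7`;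
    -- the degree `7` is that of `q` for `k = 6`.
    have hq : 0 < (11 / 8) + (7 / 2) * ζ.re + (11 / 4) * ζ.re ^ 2 := by
      rcases hcases with h | h | h | h <;>
      · have B := mul_pow_nonneg h.1 h.2
        linarith [B 0 7, B 1 6, B 2 5, B 3 4, B 4 3, B 5 2, B 6 1, B 7 0]
    rw [expand]
    simp only [Complex.add_re, Complex.smul_re, smul_eq_mul, h0, h1, h2, h3]
    linarith [mul_pos hc hq]
  · have expand : (∑ l ∈ Finset.Icc (1 : ℕ) 2, (1 / (l : ℂ)) * (1 - ζ) ^ l)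
        * (1 + 17 / 16 * ζ + 11 / 16 * ζ ^ 2) =
          (3 / 2 : ℝ) • ζ ^ 0 + (-13 / 32 : ℝ) • ζ ^ 1 + (-19 / 32 : ℝ) • ζ ^ 2 + (-27 /
          32 : ℝ) • ζ ^ 3 + (11 / 32 : ℝ) • ζ ^ 4 := by
      simp [Finset.sum_Icc_succ_top, Complex.real_smul]; ring
    have hq : 0 < (39 / 16) + (73 / 16) * ζ.re + (5 / 8) * ζ.re ^ 2 + (-11 / 4) * ζ.re ^ 3 := by
      rcases hcases with h | h | h | h <;>
      · have B := mul_pow_nonneg h.1 h.2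
        linarith [B 0 7, B 1 6, B 2 5, B 3 4, B 4 3, B 5 2, B 6 1, B 7 0]
    rw [expand]
    simp only [Complex.add_re, Complex.smul_re, smul_eq_mul, h0, h1, h2, h3, h4]
    linarith [mul_pos hc hq]
  · have expand : (∑ l ∈ Finset.Icc (1 : ℕ) 3, (1 / (l : ℂ)) * (1 - ζ) ^ l)
        * (1 + 17 / 16 * ζ + 11 / 16 * ζ ^ 2) =
          (11 / 6 : ℝ) • ζ ^ 0 + (-101 / 96 : ℝ) • ζ ^ 1 + (-41 / 96 : ℝ) • ζ ^ 2 + (-77 /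
          96 : ℝ) • ζ ^ 3 + (65 / 96 : ℝ) • ζ ^ 4 + (-11 / 48 : ℝ) • ζ ^ 5 := by
      simp [Finset.sum_Icc_succ_top, Complex.real_smul]; ring
    have hq : 0 < (47 / 16) + (151 / 48) * ζ.re + (-25 / 8) * ζ.re ^ 2 + (-7 / 4) * ζ.re ^ 3 + (11 / 3) * ζ.re ^ 4 := by
      rcases hcases with h | h | h | h <;>
      · have B := mul_pow_nonneg h.1 h.2
        linarith [B 0 7, B 1 6, B 2 5, B 3 4, B 4 3, B 5 2, B 6 1, B 7 0]
    rw [expand]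
    simp only [Complex.add_re, Complex.smul_re, smul_eq_mul, h0, h1, h2, h3, h4, h5]
    linarith [mul_pos hc hq]
  · have expand : (∑ l ∈ Finset.Icc (1 : ℕ) 4, (1 / (l : ℂ)) * (1 - ζ) ^ l)
        * (1 + 17 / 16 * ζ + 11 / 16 * ζ ^ 2) =
          (25 / 12 : ℝ) • ζ ^ 0 + (-343 / 192 : ℝ) • ζ ^ 1 + (35 / 192 : ℝ) • ζ ^ 2 + (-43
          / 48 : ℝ) • ζ ^ 3 + (43 / 48 : ℝ) • ζ ^ 4 + (-125 / 192 : ℝ) • ζ ^ 5 + (11 / 64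
          : ℝ) • ζ ^ 6 := by
      simp [Finset.sum_Icc_succ_top, Complex.real_smul]; ring
    have hq : 0 < (21 / 8) + (13 / 48) * ζ.re + (-55 / 16) * ζ.re ^ 2 + (6) * ζ.re ^ 3 + (59 / 12) * ζ.re ^ 4 + (-11 / 2) * ζ.re ^ 5 := by
      rcases hcases with h | h | h | h <;>
      · have B := mul_pow_nonneg h.1 h.2
        linarith [B 0 7, B 1 6, B 2 5, B 3 4, B 4 3, B 5 2, B 6 1, B 7 0]
    rw [expand]
    simp only [Complex.add_re, Complex.smul_re, smul_eq_mul, h0, h1, h2, h3, h4, h5, h6]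
    linarith [mul_pos hc hq]
  · have expand : (∑ l ∈ Finset.Icc (1 : ℕ) 5, (1 / (l : ℂ)) * (1 - ζ) ^ l)
        * (1 + 17 / 16 * ζ + 11 / 16 * ζ ^ 2) =
          (137 / 60 : ℝ) • ζ ^ 0 + (-2471 / 960 : ℝ) • ζ ^ 1 + (1207 / 960 : ℝ) • ζ ^ 2 +
          (-35 / 24 : ℝ) • ζ ^ 3 + (55 / 48 : ℝ) • ζ ^ 4 + (-1117 / 960 : ℝ) • ζ ^ 5 +
          (207 / 320 : ℝ) • ζ ^ 6 + (-11 / 80 : ℝ) • ζ ^ 7 := by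
      simp [Finset.sum_Icc_succ_top, Complex.real_smul]; ring
    have hq : 0 < (61 / 40) + (-367 / 240) * ζ.re + (277 / 80) * ζ.re ^ 2 + (66 / 5) * ζ.re ^ 3 + (-521 / 60) * ζ.re ^ 4 + (-119 / 10) * ζ.re ^ 5 + (44 / 5) * ζ.re ^ 6 := by
      rcases hcases with h | h | h | h <;>
      · have B := mul_pow_nonneg h.1 h.2
        linarith [B 0 7, B 1 6, B 2 5, B 3 4, B 4 3, B 5 2, B 6 1, B 7 0]
    rw [expand]
    simp only [Complex.add_re, Complex.smul_re, smul_eq_mul, h0, h1, h2, h3, h4, h5, h6, h7]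
    linarith [mul_pos hc hq]
  · have expand : (∑ l ∈ Finset.Icc (1 : ℕ) 6, (1 / (l : ℂ)) * (1 - ζ) ^ l)
        * (1 + 17 / 16 * ζ + 11 / 16 * ζ ^ 2) =
          (49 / 20 : ℝ) • ζ ^ 0 + (-1087 / 320 : ℝ) • ζ ^ 1 + (899 / 320 : ℝ) • ζ ^ 2 +
          (-271 / 96 : ℝ) • ζ ^ 3 + (175 / 96 : ℝ) • ζ ^ 4 + (-1727 / 960 : ℝ) • ζ ^ 5 +
          (1411 / 960 : ℝ) • ζ ^ 6 + (-311 / 480 : ℝ) • ζ ^ 7 + (11 / 96 : ℝ) • ζ ^ 8 := by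
      simp [Finset.sum_Icc_succ_top, Complex.real_smul]; ring
    have hq : 0 < (13 / 120) + (173 / 240) * ζ.re + (3491 / 240) * ζ.re ^ 2 + (59 / 20) * ζ.re ^ 3 + (-2081 / 60) * ζ.re ^ 4 + (91 / 10) * ζ.re ^ 5 + (134 / 5) * ζ.re ^ 6 + (-44 / 3) * ζ.re ^ 7 := by
      rcases hcases with h | h | h | h <;>
      · have B := mul_pow_nonneg h.1 h.2
        linarith [B 0 7, B 1 6, B 2 5, B 3 4, B 4 3, B 5 2, B 6 1, B 7 0]
    rw [expand]
    simp only [Complex.add_re, Complex.smul_re, smul_eq_mul, h0, h1, h2, h3, h4, h5, h6, h7, h8]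
    linarith [mul_pos hc hq]

/-- Minimum principle: an entire function whose real part is positive on the unit circle away from
`1` has positive real part on the closed unit disc away from `1`. -/
theorem re_pos_of_forall_norm_eq_one {f : ℂ → ℂ} (hf : Differentiable ℂ f) (h1 : 0 ≤ (f 1).re)
    (hpos : ∀ z, ‖z‖ = 1 → z ≠ 1 → 0 < (f z).re) {z : ℂ} (hz : ‖z‖ ≤ 1) (hz1 : z ≠ 1) :
    0 < (f z).re := by
  rcases hz.lt_or_eq with hlt | heq
  swap
  · exact hpos z heq hz1
  by_contra! hle
  -- If `Re f z ≤ 0` at an interior point, then `‖exp (-f)‖` has an interior maximum and is constant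
  -- on the closed disc, which contradicts its value at `-1`.
  set g : ℂ → ℂ := fun w => Complex.exp (-f w) with hg
  have hgd : Differentiable ℂ g := Complex.differentiable_exp.comp hf.neg
  have hgn : ∀ w, ‖g w‖ = Real.exp (-(f w).re) := fun w => by simp [hg, Complex.norm_exp]
  have hball : ∀ w ∈ Metric.closedBall (0 : ℂ) 1, ‖g w‖ ≤ 1 := by
    intro w hw
    refine Complex.norm_le_of_forall_mem_frontier_norm_le (U := Metric.ball (0 : ℂ) 1)
      Metric.isBounded_ball hgd.diffContOnCl ?_ (by rwa [closure_ball _ one_ne_zero])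
    intro u hu
    rw [frontier_ball _ one_ne_zero, mem_sphere_zero_iff_norm] at hu
    rw [hgn, Real.exp_le_one_iff, neg_nonpos]
    by_cases hu1 : u = 1
    · rwa [hu1]
    · exact (hpos u hu hu1).le
  have hgz : 1 ≤ ‖g z‖ := by rw [hgn, Real.one_le_exp_iff]; linarith
  have hmax : IsMaxOn (norm ∘ g) (Metric.ball (0 : ℂ) 1) z := fun w hw =>
    (hball w (Metric.ball_subset_closedBall hw)).trans hgz
  have hm1 : (-1 : ℂ) ≠ 1 := by norm_num
  have := Complex.norm_eqOn_closure_of_isPreconnected_of_isMaxOn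
    (convex_ball (0 : ℂ) 1).isPreconnected Metric.isOpen_ball hgd.diffContOnCl
    (mem_ball_zero_iff.2 hlt) hmax (x := -1) (by rw [closure_ball _ one_ne_zero]; simp)
  simp only [Function.comp, Function.const] at this
  have hlt1 : ‖g (-1)‖ < 1 := by
    rw [hgn, Real.exp_lt_one_iff, neg_lt_zero]
    exact hpos (-1) (by simp) hm1
  linarith

/-- `A(0)`-stability of BDF`k`, `k ≤ 6`: in the closed unit disc the symbol takes a nonpositive
real value at most at `1`. -/
theorem eq_one_of_bdfSymbol_eq_neg {k : ℕ} (hk1 : 1 ≤ k) (hk6 : k ≤ 6) {ζ : ℂ} (hζ : ‖ζ‖ ≤ 1)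
    {z : ℝ} (hz : 0 ≤ z) (h : ∑ l ∈ Finset.Icc 1 k, (1 / (l : ℂ)) * (1 - ζ) ^ l = -(z : ℂ)) :
    ζ = 1 := by
  by_contra hne
  have hm : 0 < (1 + 17 / 16 * ζ + 11 / 16 * ζ ^ 2).re := by
    refine re_pos_of_forall_norm_eq_one (f := fun ζ => 1 + 17 / 16 * ζ + 11 / 16 * ζ ^ 2)
      (by fun_prop) (by norm_num) (fun u hu _ => ?_) hζ hne
    have h2 := Complex.re_pow_add_two_of_norm_eq_one hu 0
    have e : 1 + 17 / 16 * u + 11 / 16 * u ^ 2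
        = (1 : ℝ) • u ^ 0 + (17 / 16 : ℝ) • u ^ 1 + (11 / 16 : ℝ) • u ^ 2 := by
      simp [Complex.real_smul]
    rw [e]
    simp only [Complex.add_re, Complex.smul_re, smul_eq_mul]
    simp at h2 ⊢
    rw [h2]
    nlinarith [sq_nonneg (u.re + 17 / 44)]
  have hf := re_pos_of_forall_norm_eq_one
    (f := fun ζ => (∑ l ∈ Finset.Icc 1 k, (1 / (l : ℂ)) * (1 - ζ) ^ l)
      * (1 + 17 / 16 * ζ + 11 / 16 * ζ ^ 2)) (by fun_prop)
    (by
      rw [Finset.sum_eq_zero fun l hl => ?_]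
      · simp
      · have : l ≠ 0 := by simp at hl; omega
        simp [this])
    (fun u hu hu1 => bdfSymbol_mul_re_pos hk1 hk6 hu hu1) hζ hne
  -- With the symbol equal to `-z`, the product has real part `-z Re μ ≤ 0`.
  simp only [h] at hf
  rw [neg_mul, Complex.neg_re, Complex.re_ofReal_mul] at hf
  nlinarith

/-! ### Characteristic polynomial of the scalar recurrence -/

open Polynomial in
theorem aeval_bdfPoly (k : ℕ) (ζ : ℂ) :
    aeval ζ (bdfPoly k) = ∑ l ∈ Finset.Icc 1 k, (1 / (l : ℂ)) * (1 - ζ) ^ l := by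
  simp [bdfPoly]

theorem natDegree_bdfPoly_le (k : ℕ) : (bdfPoly k).natDegree ≤ k := by
  refine Polynomial.natDegree_sum_le_of_forall_le _ _ fun l hl => ?_
  refine (Polynomial.natDegree_C_mul_le _ _).trans ?_
  refine (Polynomial.natDegree_pow_le_of_le (m := 1) l ?_).trans
    (by simpa using (Finset.mem_Icc.1 hl).2)
  exact (Polynomial.natDegree_sub_le _ _).trans (by simp)

theorem sum_bdfWeight_mul_pow (k : ℕ) (ζ : ℂ) :
    ∑ j ∈ Finset.range (k + 1), (bdfWeight k j : ℂ) * ζ ^ j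
      = ∑ l ∈ Finset.Icc 1 k, (1 / (l : ℂ)) * (1 - ζ) ^ l := by
  rw [← aeval_bdfPoly, Polynomial.aeval_eq_sum_range' (Nat.lt_succ_of_le (natDegree_bdfPoly_le k))]
  simp [bdfWeight, Algebra.smul_def]

theorem bdfWeight_zero_pos {k : ℕ} (hk : 1 ≤ k) : 0 < bdfWeight k 0 := by
  rw [bdfWeight, Polynomial.coeff_zero_eq_eval_zero, bdfPoly, Polynomial.eval_finsetSum]
  refine Finset.sum_pos (fun l hl => ?_) ⟨1, by simpa using hk⟩
  have : 0 < l := (Finset.mem_Icc.1 hl).1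
  simp [this]

/-- The homogeneous recurrence `uₙ = - r ∑_{j=1}^k ω_j u_{n-j}` of order `k`. -/
def bdfRecurrence {R : Type*} [CommRing R] [Algebra ℝ R] (k : ℕ) (r : R) : LinearRecurrence R where
  order := k
  coeffs i := -(r * algebraMap ℝ R (bdfWeight k (k - i)))

theorem sum_fin_bdfWeight {M : Type*} [AddCommMonoid M] (k : ℕ) (g : ℕ → ℕ → M) :
    ∑ i : Fin k, g (k - i) i = ∑ j ∈ Finset.range k, g (j + 1) (k - (j + 1)) := by
  rw [Fin.sum_univ_eq_sum_range (fun i => g (k - i) i), ← Finset.sum_range_reflect]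
  refine Finset.sum_congr rfl fun j hj => ?_
  rw [Finset.mem_range] at hj
  congr 1 <;> omega

theorem eval_charPoly_bdfRecurrence (k : ℕ) (r x : ℂ) :
    (bdfRecurrence k r).charPoly.eval x
      = x ^ k + r * ∑ j ∈ Finset.range k, (bdfWeight k (j + 1) : ℂ) * x ^ (k - (j + 1)) := by
  have := sum_fin_bdfWeight k fun j i => -(r * (bdfWeight k j : ℂ)) * x ^ i
  simp only [LinearRecurrence.charPoly, bdfRecurrence, Polynomial.eval_sub, Polynomial.eval_monomial,
    Polynomial.eval_finsetSum, Complex.coe_algebraMap, one_mul]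
  change x ^ k - ∑ i : Fin k, -(r * (bdfWeight k (k - i) : ℂ)) * x ^ (i : ℕ) = _
  rw [this, Finset.mul_sum, sub_eq_add_neg, ← Finset.sum_neg_distrib]
  congr 1
  exact Finset.sum_congr rfl fun _ _ => by ring

/-- The substitution `ζ = 1/x` expresses the characteristic polynomial through the symbol,
exchanging the exterior of the disc with its interior. -/
theorem eval_charPoly_bdfRecurrence_of_ne_zero (k : ℕ) (r : ℂ) {x : ℂ} (hx : x ≠ 0) :
    (bdfRecurrence k r).charPoly.eval x
      = x ^ k * (1 - r * bdfWeight k 0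
        + r * ∑ l ∈ Finset.Icc 1 k, (1 / (l : ℂ)) * (1 - x⁻¹) ^ l) := by
  rw [← sum_bdfWeight_mul_pow, Finset.sum_range_succ', eval_charPoly_bdfRecurrence, pow_zero,
    mul_one, show ∀ a b : ℂ, 1 - r * b + r * (a + b) = 1 + r * a by intros; ring, mul_add, mul_one,
    mul_left_comm, Finset.mul_sum (Finset.range k) _ (x ^ k)]
  refine congr_arg (x ^ k + r * ·) (Finset.sum_congr rfl fun j hj => ?_)
  rw [mul_left_comm, inv_pow, ← div_eq_mul_inv, pow_sub₀ _ hx (Finset.mem_range.1 hj),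
    div_eq_mul_inv]

theorem charPoly_bdfRecurrence_root {k : ℕ} (hk1 : 1 ≤ k) (hk6 : k ≤ 6) {r : ℝ} (hr0 : 0 ≤ r)
    (hr1 : r * bdfWeight k 0 ≤ 1) {a : ℂ} (ha : 1 ≤ ‖a‖)
    (h : (bdfRecurrence k (r : ℂ)).charPoly.eval a = 0) : a = 1 ∧ r * bdfWeight k 0 = 1 := by
  have ha0 : a ≠ 0 := norm_pos_iff.1 (by linarith)
  rw [eval_charPoly_bdfRecurrence_of_ne_zero _ _ ha0, mul_eq_zero,
    or_iff_right (pow_ne_zero _ ha0)] at h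
  have hr : r ≠ 0 := by
    rintro rfl
    simp at h
  have hrc : (r : ℂ) ≠ 0 := by exact_mod_cast hr
  have hz : 0 ≤ (1 - r * bdfWeight k 0) / r := div_nonneg (by linarith) hr0
  have key := eq_one_of_bdfSymbol_eq_neg hk1 hk6 (ζ := a⁻¹)
    (by rw [norm_inv]; exact inv_le_one_of_one_le₀ ha) hz (by
      push_cast
      rw [eq_neg_iff_add_eq_zero, ← mul_right_inj' hrc, mul_add, mul_div_cancel₀ _ hrc, mul_zero,
        ← h]
      ring)
  have ha1 : a = 1 := by simpa using key
  refine ⟨ha1, ?_⟩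
  rw [ha1, Finset.sum_eq_zero fun l hl => ?_] at h
  · have h' : ((1 - r * bdfWeight k 0 : ℝ) : ℂ) = 0 := by push_cast; linear_combination h
    rw [Complex.ofReal_eq_zero] at h'
    linarith
  · have : l ≠ 0 := by simp at hl; omega
    simp [this]

open Polynomial in
-- Zero-stability: for `rω₀ = 1` the polynomial is `r ∑_l (x - 1)^l x^(k-l) / l`, whose derivative
-- at `1` comes from `l = 1` alone and equals `r ≠ 0`. So the root `1` is simple.
theorem charPoly_bdfRecurrence_ne_sub_one_sq_mul {k : ℕ} (hk1 : 1 ≤ k) {r : ℝ}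
    (hr1 : r * bdfWeight k 0 = 1) (q : ℂ[X]) :
    (bdfRecurrence k (r : ℂ)).charPoly ≠ (X - 1) * ((X - 1) * q) := by
  intro h
  have hr : (r : ℂ) ≠ 0 := by
    rintro h0
    rw [Complex.ofReal_eq_zero] at h0
    simp [h0] at hr1
  have hr1' : (r : ℂ) * bdfWeight k 0 = 1 := by exact_mod_cast hr1
  have e : (bdfRecurrence k (r : ℂ)).charPoly
      = C (r : ℂ) * ∑ l ∈ Finset.Icc 1 k, C (1 / (l : ℂ)) * ((X - 1) ^ l * X ^ (k - l)) := by
    refine eq_of_infinite_eval_eq _ _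
      ((Set.finite_singleton (0 : ℂ)).infinite_compl.mono fun x hx => ?_)
    have hx : x ≠ 0 := hx
    rw [Set.mem_ofPred_eq, eval_charPoly_bdfRecurrence_of_ne_zero _ _ hx, hr1', sub_self, zero_add,
      mul_left_comm, Finset.mul_sum]
    simp only [eval_mul, eval_C, eval_finsetSum, eval_pow, eval_sub, eval_X, eval_one]
    congr 1
    refine Finset.sum_congr rfl fun l hl => ?_
    rw [pow_sub₀ _ hx (Finset.mem_Icc.1 hl).2, mul_left_comm, show x - 1 = x * (1 - x⁻¹) by
      field_simp, mul_pow]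
    field_simp
  have h1 := congr_arg (fun p => eval 1 (derivative p)) (e.symm.trans h)
  simp only [derivative_mul, derivative_C, derivative_sum, eval_finsetSum, eval_add, eval_mul, eval_C,
    zero_mul, zero_add, derivative_sub, derivative_X, derivative_one, eval_sub, eval_X,
    eval_one, sub_self, sub_zero, one_mul, add_zero, eval_pow, derivative_pow,
    one_pow, mul_one, mul_eq_zero, hr, false_or] at h1
  rw [Finset.sum_eq_single_of_mem 1 (by simpa using hk1) fun l hl hl1 => ?_] at h1
  · simp at h1
  · have h2 : l ≠ 0 := by simp at hl; omega
    have h3 : l - 1 ≠ 0 := by simp at hl; omega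
    simp [h2, h3]

end

noncomputable section

open Polynomial

/-! ### Uniform bounds for linear recurrences -/

/-- The shift operator on sequences. -/
def seqShift (R : Type*) [CommRing R] : Module.End R (ℕ → R) := LinearMap.funLeft R R Nat.succ

theorem seqShift_apply {R : Type*} [CommRing R] (u : ℕ → R) (n : ℕ) : seqShift R u n = u (n + 1) :=
  rfl

theorem seqShift_pow_apply {R : Type*} [CommRing R] (j : ℕ) (u : ℕ → R) (n : ℕ) :
    (seqShift R ^ j) u n = u (n + j) := by
  induction j generalizing u with
  | zero => simp
  | succ j ih => rw [pow_succ, Module.End.mul_apply, ih, seqShift_apply]; rfl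

theorem aeval_seqShift_sub_C_apply {R : Type*} [CommRing R] (a : R) (u : ℕ → R) (n : ℕ) :
    aeval (seqShift R) (X - C a) u n = u (n + 1) - a * u n := by
  simp [seqShift_apply, Module.algebraMap_end_apply]

theorem LinearRecurrence.IsSolution.aeval_charPoly {R : Type*} [CommRing R]
    {E : LinearRecurrence R} {u : ℕ → R} (hu : E.IsSolution u) :
    aeval (seqShift R) E.charPoly u = 0 := by
  ext n
  have h : ∀ (j : ℕ) (c : R), aeval (seqShift R) (monomial j c) u n = c * u (n + j) := by
    intro j c
    simp [aeval_monomial, Module.algebraMap_end_apply, Module.End.mul_apply, seqShift_pow_apply]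
  rw [charPoly, map_sub, map_sum, LinearMap.sub_apply, LinearMap.sum_apply, Pi.sub_apply,
    Finset.sum_apply, h]
  simp [seqShift_pow_apply, hu n]

/-- A sequence is bounded by its first values and by its image under a product of factors
`S - a i` with `‖a i‖ ≤ ρ < 1`, where `S` is the shift. -/
theorem exists_norm_le_of_aeval_prod {ρ : ℝ} (hρ0 : 0 ≤ ρ) (hρ1 : ρ < 1) {ι : Type*} (n : ℕ) :
    ∃ K : ℝ, 0 ≤ K ∧ ∀ (s : Finset ι), s.card = n → ∀ (a : ι → ℂ), (∀ i ∈ s, ‖a i‖ ≤ ρ) →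
      ∀ (u : ℕ → ℂ) (M I : ℝ), 0 ≤ I →
        (∀ m, ‖aeval (seqShift ℂ) (∏ i ∈ s, (X - C (a i))) u m‖ ≤ M) →
        (∀ j < n, ‖u j‖ ≤ I) → ∀ m, ‖u m‖ ≤ K * (M + I) := by
  induction n with
  | zero =>
    refine ⟨1, zero_le_one, fun s hs a _ u M I hI hM _ m => ?_⟩
    have := hM m
    simp only [Finset.card_eq_zero.1 hs, Finset.prod_empty, map_one, Module.End.one_apply] at this
    linarith
  | succ n ih =>
    obtain ⟨K, hK, ih⟩ := ih
    have h1ρ : 0 < 1 - ρ := sub_pos.2 hρ1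
    refine ⟨1 + 2 * K / (1 - ρ), by positivity, fun s hs a ha u M I hI hM hu m => ?_⟩
    obtain ⟨i, t, hit, rfl, ht⟩ := Finset.card_eq_succ_iff_cons.1 hs
    have hai : ‖a i‖ ≤ ρ := ha i (Finset.mem_cons_self i t)
    -- One factor is peeled off: induction bounds `w = (S - a i) u`, whose first values are at most
    -- `2 * I`, and the first-order recurrence is then solved back, with geometric sum at most `1 /
    -- (1 - ρ)`.
    set w := aeval (seqShift ℂ) (X - C (a i)) u with hw
    have hwn : ∀ m, w m = u (m + 1) - a i * u m := aeval_seqShift_sub_C_apply (a i) u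
    have hwb : ∀ m, ‖w m‖ ≤ K * (M + 2 * I) := by
      refine ih t ht a (fun j hj => ha j (Finset.mem_cons_of_mem hj)) w M (2 * I) (by positivity)
        (fun m => ?_) fun j hj => ?_
      · have := hM m
        rwa [Finset.prod_cons, mul_comm, map_mul, Module.End.mul_apply] at this
      · rw [hwn]
        have h1 := hu (j + 1) (by omega)
        have h2 := hu j (by omega)
        calc ‖u (j + 1) - a i * u j‖ ≤ ‖u (j + 1)‖ + ‖a i‖ * ‖u j‖ := by
              rw [← norm_mul]; exact norm_sub_le _ _
          _ ≤ I + 1 * I := by gcongr; linarith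
          _ = 2 * I := by ring
    have hM0 : 0 ≤ M := (norm_nonneg _).trans (hM 0)
    have hub : ∀ m, ‖u m‖ ≤ I + K * (M + 2 * I) / (1 - ρ) := by
      intro m
      induction m with
      | zero =>
        have : 0 ≤ K * (M + 2 * I) / (1 - ρ) := by positivity
        linarith [hu 0 (by omega)]
      | succ m ihm =>
        have e : u (m + 1) = w m + a i * u m := by rw [hwn]; ring
        calc ‖u (m + 1)‖ ≤ ‖w m‖ + ‖a i‖ * ‖u m‖ := by
              rw [e, ← norm_mul]; exact norm_add_le _ _
          _ ≤ K * (M + 2 * I) + ρ * (I + K * (M + 2 * I) / (1 - ρ)) := by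
              gcongr
              exact hwb m
          _ = ρ * I + K * (M + 2 * I) / (1 - ρ) := by field_simp; ring
          _ ≤ _ := by gcongr; nlinarith
    refine (hub m).trans ?_
    have hL : 0 ≤ K / (1 - ρ) := by positivity
    rw [mul_div_right_comm, mul_div_assoc]
    nlinarith [mul_nonneg hL hM0]

/-- At index `0`, a product of `n` factors `S - a i` with `‖a i‖ ≤ 1` is bounded by
the first `n + 1` values. -/
theorem norm_aeval_prod_zero_le {ι : Type*} (s : Finset ι) {a : ι → ℂ} (ha : ∀ i ∈ s, ‖a i‖ ≤ 1)
    {u : ℕ → ℂ} {I : ℝ} (hu : ∀ j ≤ s.card, ‖u j‖ ≤ I) :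
    ‖aeval (seqShift ℂ) (∏ i ∈ s, (X - C (a i))) u 0‖ ≤ 2 ^ s.card * I := by
  induction s using Finset.cons_induction generalizing u I with
  | empty => simpa using hu 0 (by simp)
  | cons i t hit ih =>
    rw [Finset.prod_cons, mul_comm, map_mul, Module.End.mul_apply, Finset.card_cons, pow_succ,
      mul_assoc]
    refine ih (fun j hj => ha j (Finset.mem_cons_of_mem hj)) fun j hj => ?_
    rw [Finset.card_cons] at hu
    rw [aeval_seqShift_sub_C_apply]
    have h1 := hu (j + 1) (by omega)
    have h2 := hu j (by omega)
    have h3 := ha i (Finset.mem_cons_self i t)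
    calc ‖u (j + 1) - a i * u j‖ ≤ ‖u (j + 1)‖ + ‖a i‖ * ‖u j‖ := by
          rw [← norm_mul]; exact norm_sub_le _ _
      _ ≤ I + 1 * I := by gcongr
      _ = 2 * I := by ring

/-- Solutions of a linear recurrence are bounded by their initial values, uniformly over all
recurrences whose characteristic roots lie in the closed unit disc and, all but one of
them, in the disc of radius `ρ < 1`. -/
theorem exists_norm_le_of_charPoly_eq_prod {ρ : ℝ} (hρ0 : 0 ≤ ρ) (hρ1 : ρ < 1) (k : ℕ)
    (hk : 1 ≤ k) :
    ∃ K : ℝ, 0 ≤ K ∧ ∀ (E : LinearRecurrence ℂ) (a : Fin k → ℂ),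
      E.charPoly = ∏ i, (X - C (a i)) → (∀ i, ‖a i‖ ≤ 1) →
      (∀ i j, i ≠ j → min ‖a i‖ ‖a j‖ ≤ ρ) →
      ∀ u, E.IsSolution u → ∀ I, (∀ j < k, ‖u j‖ ≤ I) → ∀ m, ‖u m‖ ≤ K * I := by
  obtain ⟨K, hK, h⟩ := exists_norm_le_of_aeval_prod hρ0 hρ1 (ι := Fin k) (k - 1)
  refine ⟨K * (2 ^ (k - 1) + 1), by positivity, fun E a hE ha hmin u hu I hI m => ?_⟩
  have : Nonempty (Fin k) := ⟨⟨0, hk⟩⟩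
  -- Once a root of largest modulus is set aside, all others have modulus at most `ρ`. Their product
  -- applied to `u` is a geometric sequence with ratio `a i`, hence bounded since `‖a i‖ ≤ 1`.
  obtain ⟨i, hi⟩ := Finite.exists_max fun i => ‖a i‖
  have hcard : (Finset.univ.erase i).card = k - 1 := by
    rw [Finset.card_erase_of_mem (Finset.mem_univ i), Finset.card_univ, Fintype.card_fin]
  have hI0 : 0 ≤ I := (norm_nonneg _).trans (hI 0 hk)
  set v := aeval (seqShift ℂ) (∏ j ∈ Finset.univ.erase i, (X - C (a j))) u with hv
  have hv0 : ‖v 0‖ ≤ 2 ^ (k - 1) * I := by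
    rw [← hcard]
    exact norm_aeval_prod_zero_le _ (fun j _ => ha j) fun j hj => hI j (by omega)
  have hvs : ∀ n, v (n + 1) = a i * v n := by
    intro n
    rw [← sub_eq_zero, ← aeval_seqShift_sub_C_apply, hv, ← Module.End.mul_apply, ← map_mul,
      Finset.mul_prod_erase _ (fun j => X - C (a j)) (Finset.mem_univ i), ← hE,
      hu.aeval_charPoly]
    rfl
  have hvb : ∀ n, ‖v n‖ ≤ 2 ^ (k - 1) * I := by
    intro n
    induction n with
    | zero => exact hv0
    | succ n ih =>
      rw [hvs, norm_mul]
      exact (mul_le_of_le_one_left (norm_nonneg _) (ha i)).trans ih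
  refine (h _ hcard a (fun j hj => ?_) u _ I hI0 hvb (fun j hj => hI j (by omega)) m).trans_eq
    (by ring)
  have := hmin j i (Finset.ne_of_mem_erase hj)
  rwa [min_eq_left (hi j)] at this

/-! ### Uniform root location and scalar stability -/

theorem Polynomial.Monic.exists_eq_prod_fin {p : ℂ[X]} (hp : p.Monic) {k : ℕ}
    (hk : p.natDegree = k) : ∃ a : Fin k → ℂ, p = ∏ i, (X - C (a i)) := by
  have hs := IsAlgClosed.splits p
  obtain ⟨l, hl⟩ := Quot.exists_rep p.roots
  have hlen : l.length = k := by
    rw [← hk, hs.natDegree_eq_card_roots, ← hl]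
    rfl
  subst hlen
  refine ⟨l.get, ?_⟩
  conv_lhs => rw [hs.eq_prod_roots_of_monic hp, ← hl]
  exact (Fin.prod_univ_fun_getElem l fun a => X - C a).symm

/-- The characteristic roots of the BDF recurrences with parameter `r ∈ [0, 1 / ω₀]` lie in the
closed unit disc and, all but one of them, in a common smaller disc. -/
theorem exists_min_norm_root_le {k : ℕ} (hk1 : 1 ≤ k) (hk6 : k ≤ 6) :
    ∃ ρ : ℝ, 0 ≤ ρ ∧ ρ < 1 ∧ ∀ (r : ℝ), 0 ≤ r → r * bdfWeight k 0 ≤ 1 → ∀ a : Fin k → ℂ,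
      (bdfRecurrence k (r : ℂ)).charPoly = ∏ i, (X - C (a i)) →
      (∀ i, ‖a i‖ ≤ 1) ∧ ∀ i j, i ≠ j → min ‖a i‖ ‖a j‖ ≤ ρ := by
  have hω := bdfWeight_zero_pos hk1
  have hroot : ∀ (r : ℝ) (a : Fin k → ℂ),
      (bdfRecurrence k (r : ℂ)).charPoly = ∏ i, (X - C (a i)) →
      ∀ i, (bdfRecurrence k (r : ℂ)).charPoly.eval (a i) = 0 := by
    intro r a h i
    rw [h, eval_prod]
    exact Finset.prod_eq_zero (Finset.mem_univ i) (by simp)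
  have hle : ∀ (r : ℝ), 0 ≤ r → r * bdfWeight k 0 ≤ 1 → ∀ a : Fin k → ℂ,
      (bdfRecurrence k (r : ℂ)).charPoly = ∏ i, (X - C (a i)) → ∀ i, ‖a i‖ ≤ 1 := by
    intro r hr0 hr1 a h i
    by_contra! hlt
    have := (charPoly_bdfRecurrence_root hk1 hk6 hr0 hr1 hlt.le (hroot r a h i)).1
    simp [this] at hlt
  -- Pairs of a parameter and an enumeration of its roots form a compact set, so `min ‖a i‖ ‖a j‖`
  -- attains its maximum there. A maximum of at least `1` would make `1` a double root.
  set K : Set (ℝ × (Fin k → ℂ)) := {p | (0 ≤ p.1 ∧ p.1 * bdfWeight k 0 ≤ 1) ∧ (∀ i, ‖p.2 i‖ ≤ 1) ∧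
    ∀ x : ℂ, (bdfRecurrence k (p.1 : ℂ)).charPoly.eval x = ∏ i, (x - p.2 i)} with hK
  have hKc : IsCompact K := by
    refine IsCompact.of_isClosed_subset ((isCompact_Icc (a := 0) (b := 1 / bdfWeight k 0)).prod
      (isCompact_univ_pi fun _ : Fin k => isCompact_closedBall (0 : ℂ) 1)) ?_ ?_
    · simp only [hK, eval_charPoly_bdfRecurrence, Set.ofPred_and, Set.ofPred_forall]
      refine ((isClosed_le (by fun_prop) (by fun_prop)).inter
        (isClosed_le (by fun_prop) (by fun_prop))).inter
        ((isClosed_iInter fun i => isClosed_le (by fun_prop) (by fun_prop)).inter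
          (isClosed_iInter fun x => isClosed_eq (by fun_prop) (by fun_prop)))
    · rintro p ⟨⟨h0, h1⟩, ha, -⟩
      exact ⟨⟨h0, (le_div_iff₀ hω).2 h1⟩, fun i _ => by simpa using ha i⟩
  have hpair : ∀ q : Fin k × Fin k, ∃ ρ : ℝ, 0 ≤ ρ ∧ ρ < 1 ∧
      (q.1 ≠ q.2 → ∀ p ∈ K, min ‖p.2 q.1‖ ‖p.2 q.2‖ ≤ ρ) := by
    rintro ⟨i, j⟩
    by_cases hij : i = j
    · exact ⟨0, le_rfl, zero_lt_one, fun h => absurd hij h⟩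
    rcases K.eq_empty_or_nonempty with hKe | hKn
    · exact ⟨0, le_rfl, zero_lt_one, fun _ p hp => by simp [hKe] at hp⟩
    obtain ⟨⟨r, a⟩, hp, hmax⟩ := hKc.exists_isMaxOn hKn
      (f := fun p => min ‖p.2 i‖ ‖p.2 j‖) (by fun_prop)
    refine ⟨min ‖a i‖ ‖a j‖, by positivity, ?_, fun _ p hp => hmax hp⟩
    obtain ⟨⟨hr0, hr1⟩, ha, hE⟩ := hp
    have hE' : (bdfRecurrence k (r : ℂ)).charPoly = ∏ i, (X - C (a i)) :=
      Polynomial.funext fun x => by rw [hE, eval_prod]; simp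
    by_contra! hlt
    obtain ⟨hi, hr⟩ := charPoly_bdfRecurrence_root hk1 hk6 hr0 hr1 (hlt.trans (min_le_left _ _))
      (hroot r a hE' i)
    obtain ⟨hj, -⟩ := charPoly_bdfRecurrence_root hk1 hk6 hr0 hr1 (hlt.trans (min_le_right _ _))
      (hroot r a hE' j)
    refine charPoly_bdfRecurrence_ne_sub_one_sq_mul hk1 hr
      (∏ l ∈ (Finset.univ.erase i).erase j, (X - C (a l))) ?_
    rw [hE', ← Finset.mul_prod_erase _ _ (Finset.mem_univ i),
      ← Finset.mul_prod_erase _ _ (Finset.mem_erase.2 ⟨Ne.symm hij, Finset.mem_univ j⟩), hi, hj,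
      C_1]
  choose ρ hρ0 hρ1 hρ using hpair
  have : Nonempty (Fin k × Fin k) := ⟨⟨⟨0, hk1⟩, ⟨0, hk1⟩⟩⟩
  obtain ⟨q, hq⟩ := Finite.exists_max ρ
  refine ⟨ρ q, hρ0 q, hρ1 q, fun r hr0 hr1 a h => ⟨hle r hr0 hr1 a h, fun i j hij => ?_⟩⟩
  refine (hρ (i, j) hij (r, a) ⟨⟨hr0, hr1⟩, hle r hr0 hr1 a h, fun x => ?_⟩).trans (hq (i, j))
  rw [h, eval_prod]
  simp

/-- Uniform stability of the scalar BDF recurrences. -/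
theorem exists_norm_le_of_isSolution_bdfRecurrence {k : ℕ} (hk1 : 1 ≤ k) (hk6 : k ≤ 6) :
    ∃ K : ℝ, 0 ≤ K ∧ ∀ (r : ℝ), 0 ≤ r → r * bdfWeight k 0 ≤ 1 →
      ∀ u : ℕ → ℂ, (bdfRecurrence k (r : ℂ)).IsSolution u → ∀ I, (∀ j < k, ‖u j‖ ≤ I) →
        ∀ m, ‖u m‖ ≤ K * I := by
  obtain ⟨ρ, hρ0, hρ1, hρ⟩ := exists_min_norm_root_le hk1 hk6
  obtain ⟨K, hK0, hK⟩ := exists_norm_le_of_charPoly_eq_prod hρ0 hρ1 k hk1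
  refine ⟨K, hK0, fun r hr0 hr1 u hu I hI m => ?_⟩
  obtain ⟨a, ha⟩ := (bdfRecurrence k (r : ℂ)).charPoly_monic.exists_eq_prod_fin
    (k := k) (natDegree_eq_of_degree_eq_some (bdfRecurrence k (r : ℂ)).charPoly_degree_eq_order)
  obtain ⟨h1, h2⟩ := hρ r hr0 hr1 a ha
  exact hK _ a ha h1 h2 u hu I hI m

/-! ### From scalars to operators -/

/-- The polynomial in `r` that expresses the `m`-th term of a solution of the recurrence
`uₙ = - r ∑_{j=1}^k ω_j u_{n-j}` through its `i`-th initial value. -/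
def bdfFundamental (k : ℕ) (i : Fin k) (m : ℕ) : ℝ[X] :=
  (bdfRecurrence k (X : ℝ[X])).mkSol (Pi.single i 1) m

theorem bdfFundamental_of_lt {k : ℕ} (i j : Fin k) :
    bdfFundamental k i j = (Pi.single i 1 : Fin k → ℝ[X]) j :=
  (bdfRecurrence k (X : ℝ[X])).mkSol_eq_init (Pi.single i 1) j

theorem bdfFundamental_add {k : ℕ} (i : Fin k) (m : ℕ) :
    bdfFundamental k i (m + k)
      = ∑ j : Fin k, -(X * C (bdfWeight k (k - j))) * bdfFundamental k i (m + j) :=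
  (bdfRecurrence k (X : ℝ[X])).is_sol_mkSol (Pi.single i 1) m

theorem exists_abs_eval_bdfFundamental_le {k : ℕ} (hk1 : 1 ≤ k) (hk6 : k ≤ 6) :
    ∃ K : ℝ, 0 ≤ K ∧ ∀ (r : ℝ), 0 ≤ r → r * bdfWeight k 0 ≤ 1 → ∀ (i : Fin k) (m : ℕ),
      |(bdfFundamental k i m).eval r| ≤ K := by
  obtain ⟨K, hK0, hK⟩ := exists_norm_le_of_isSolution_bdfRecurrence hk1 hk6
  refine ⟨K, hK0, fun r hr0 hr1 i m => ?_⟩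
  have := hK r hr0 hr1 (fun m => (((bdfFundamental k i m).eval r : ℝ) : ℂ)) (fun n => ?_) 1
    (fun j hj => ?_) m
  · simpa [Complex.norm_real] using this
  · change (((bdfFundamental k i (n + k)).eval r : ℝ) : ℂ) =
      ∑ j : Fin k, -((r : ℂ) * (bdfWeight k (k - j) : ℂ)) *
        (((bdfFundamental k i (n + j)).eval r : ℝ) : ℂ)
    rw [bdfFundamental_add, eval_finsetSum]
    push_cast
    refine Finset.sum_congr rfl fun j _ => ?_
    simp only [eval_mul, eval_neg, eval_X, eval_C]
    push_cast
    ring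
  · rw [bdfFundamental_of_lt i ⟨j, hj⟩]
    by_cases h : (⟨j, hj⟩ : Fin k) = i
    · subst h; simp
    · simp [h]

/-- Continuous functional calculus: the real spectrum of `R` lies in `[0, ‖R‖]`. -/
theorem norm_aeval_le_of_nonneg {H : Type*} [NormedAddCommGroup H] [InnerProductSpace ℂ H]
    [CompleteSpace H] {R : H →L[ℂ] H} (hR : 0 ≤ R) {p : ℝ[X]} {K : ℝ} (hK : 0 ≤ K)
    (h : ∀ x, 0 ≤ x → x ≤ ‖R‖ → |p.eval x| ≤ K) : ‖aeval R p‖ ≤ K := by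
  have hsa : IsSelfAdjoint R := hR.isSelfAdjoint
  rw [← cfc_polynomial (R := ℝ) p R hsa]
  refine norm_cfc_le hK fun x hx => ?_
  refine h x (spectrum_nonneg_of_nonneg hR hx) ((le_abs_self x).trans ?_)
  exact (spectrum.norm_le_norm_mul_of_mem hx).trans
    (mul_le_of_le_one_right (norm_nonneg R) ContinuousLinearMap.norm_id_le)

/-- Only the single operator `R` enters the recurrence, so the scalar fundamental solutions,
evaluated at `R`, solve it. -/
theorem eq_sum_aeval_bdfFundamental {H : Type*} [NormedAddCommGroup H] [InnerProductSpace ℂ H]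
    {k : ℕ} {R : H →L[ℂ] H} {y : ℕ → H} {M : ℕ}
    (hy : ∀ m < M, y (m + k) = -R (∑ j : Fin k, bdfWeight k (k - j) • y (m + j))) :
    ∀ m < M + k, y m = ∑ i : Fin k, aeval R (bdfFundamental k i m) (y i) := by
  intro m
  induction m using Nat.strong_induction_on with
  | _ m ih =>
    intro hm
    rcases lt_or_ge m k with hmk | hmk
    · rw [Finset.sum_eq_single_of_mem (⟨m, hmk⟩ : Fin k) (Finset.mem_univ _) fun i _ hi => ?_]
      · rw [bdfFundamental_of_lt ⟨m, hmk⟩ ⟨m, hmk⟩]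
        simp
      · rw [bdfFundamental_of_lt i ⟨m, hmk⟩, Pi.single_eq_of_ne hi.symm]
        simp
    · obtain ⟨n, rfl⟩ := Nat.exists_eq_add_of_le' hmk
      rw [hy n (by omega)]
      have e : ∀ j : Fin k, y (n + j) = ∑ i : Fin k, aeval R (bdfFundamental k i (n + j)) (y i) :=
        fun j => ih (n + j) (by omega) (by omega)
      simp only [bdfFundamental_add, e, map_sum, map_mul, map_neg, aeval_X, aeval_C,
        sum_apply, Finset.smul_sum]
      rw [← Finset.sum_neg_distrib, Finset.sum_comm]
      refine Finset.sum_congr rfl fun j _ => ?_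
      rw [← Finset.sum_neg_distrib]
      refine Finset.sum_congr rfl fun i _ => ?_
      rw [Algebra.algebraMap_eq_smul_one]
      rfl

/-- Uniform stability of BDF`k` recurrences with an operator coefficient. -/
theorem exists_norm_le_of_bdf_operator {k : ℕ} (hk1 : 1 ≤ k) (hk6 : k ≤ 6) :
    ∃ K : ℝ, 0 ≤ K ∧ ∀ (H : Type*) [NormedAddCommGroup H] [InnerProductSpace ℂ H] [CompleteSpace H]
      (R : H →L[ℂ] H), 0 ≤ R → ‖R‖ * bdfWeight k 0 ≤ 1 → ∀ (y : ℕ → H) (M : ℕ),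
      (∀ m < M, y (m + k) = -R (∑ j : Fin k, bdfWeight k (k - j) • y (m + j))) →
      ∀ m < M + k, ‖y m‖ ≤ K * ∑ i ∈ Finset.range k, ‖y i‖ := by
  obtain ⟨K, hK0, hK⟩ := exists_abs_eval_bdfFundamental_le hk1 hk6
  refine ⟨K, hK0, fun H _ _ _ R hR hR1 y M hy m hm => ?_⟩
  rw [eq_sum_aeval_bdfFundamental hy m hm, Finset.mul_sum, Finset.sum_range]
  refine norm_sum_le_of_le _ fun i _ => ContinuousLinearMap.le_of_opNorm_le _ ?_ _
  refine norm_aeval_le_of_nonneg hR hK0 fun x hx0 hx => hK x hx0 ?_ i m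
  exact (mul_le_mul_of_nonneg_right hx (bdfWeight_zero_pos hk1).le).trans hR1

/-! ### The elliptic problem of one time step -/

section LaxMilgram

variable {H V : Type*} [NormedAddCommGroup H] [InnerProductSpace ℂ H] [CompleteSpace H]
  [NormedAddCommGroup V] [InnerProductSpace ℂ V] [CompleteSpace V]

/-- The bounded operator on `V` that represents the form `ω (ι x, ι w) + τ ⟨A x, w⟩`. -/
def shiftedOperator (ι : V →L[ℂ] H) (A : V →L[ℂ] AntiDual V) (ω τ : ℝ) : V →L[ℂ] V :=
  (ω : ℂ) • (ContinuousLinearMap.adjoint ι ∘L ι)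
    + (τ : ℂ) • InnerProductSpace.continuousLinearMapOfBilin A.flip

variable {ι : V →L[ℂ] H} {A : V →L[ℂ] AntiDual V} {β₀ β₁ ω τ : ℝ}

theorem inner_shiftedOperator_left (x w : V) :
    inner ℂ (shiftedOperator ι A ω τ x) w = ω * inner ℂ (ι x) (ι w) + τ * A w x := by
  rw [shiftedOperator, add_apply, inner_add_left,
    smul_apply, smul_apply, inner_smul_left,
    inner_smul_left, InnerProductSpace.continuousLinearMapOfBilin_apply,
    ContinuousLinearMap.comp_apply, ContinuousLinearMap.adjoint_inner_left, Complex.conj_ofReal,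
    Complex.conj_ofReal]
  rfl

theorem IsEllipticOperator.inner_shiftedOperator_right (hA : IsEllipticOperator A β₀ β₁) (x w : V) :
    inner ℂ w (shiftedOperator ι A ω τ x) = ω * inner ℂ (ι w) (ι x) + τ * A x w := by
  rw [← inner_conj_symm, inner_shiftedOperator_left, map_add, map_mul, map_mul, inner_conj_symm,
    ← hA.selfAdjoint, Complex.conj_ofReal, Complex.conj_ofReal]

theorem IsEllipticOperator.re_inner_shiftedOperator (hA : IsEllipticOperator A β₀ β₁) (hτ : 0 ≤ τ)
    (x : V) :
    ω * ‖ι x‖ ^ 2 + τ * (β₀ * ‖x‖ ^ 2) ≤ (inner ℂ x (shiftedOperator ι A ω τ x)).re := by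
  rw [hA.inner_shiftedOperator_right, Complex.add_re, Complex.re_ofReal_mul, Complex.re_ofReal_mul,
    ← inner_self_eq_norm_sq (𝕜 := ℂ)]
  exact add_le_add le_rfl (mul_le_mul_of_nonneg_left (hA.lower x) hτ)

theorem IsEllipticOperator.isUnit_shiftedOperator (hA : IsEllipticOperator A β₀ β₁) (hβ : 0 < β₀)
    (hω : 0 ≤ ω) (hτ : 0 < τ) : IsUnit (shiftedOperator ι A ω τ) := by
  refine ContinuousLinearMap.isUnit_of_forall_le_norm_inner_map _ (c := ⟨τ * β₀, by positivity⟩)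
    (by exact mul_pos hτ hβ) fun x => ?_
  rw [norm_inner_symm]
  refine le_trans ?_ (Complex.re_le_norm _)
  refine le_trans ?_ (hA.re_inner_shiftedOperator hτ.le x)
  have : 0 ≤ ω * ‖ι x‖ ^ 2 := by positivity
  change ‖x‖ ^ 2 * (τ * β₀) ≤ _
  linarith

/-- Lax–Milgram for the form `ω (ι x, ι w) + τ ⟨A x, w⟩`. -/
theorem IsEllipticOperator.existsUnique (hA : IsEllipticOperator A β₀ β₁) (hβ : 0 < β₀)
    (hω : 0 ≤ ω) (hτ : 0 < τ) (g : AntiDual V) :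
    ∃! x : V, ∀ w : V, ω * inner ℂ (ι w) (ι x) + τ * A x w = g w := by
  obtain ⟨z, hz⟩ : ∃ z : V, ∀ w, inner ℂ w z = g w := by
    refine ⟨(InnerProductSpace.toDual ℂ V).symm
      (((starL ℂ : ℂ ≃L⋆[ℂ] ℂ) : ℂ →L⋆[ℂ] ℂ).comp g), fun w => ?_⟩
    rw [← inner_conj_symm, InnerProductSpace.toDual_symm_apply]
    exact star_star (g w)
  have hbij := (ContinuousLinearMap.isUnit_iff_bijective).1
    (hA.isUnit_shiftedOperator (ι := ι) hβ hω hτ)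
  have hiff : ∀ x, (∀ w : V, ω * inner ℂ (ι w) (ι x) + τ * A x w = g w) ↔
      shiftedOperator ι A ω τ x = z := by
    intro x
    simp_rw [← hz, ← hA.inner_shiftedOperator_right]
    exact ⟨ext_inner_left ℂ, fun h w => by rw [h]⟩
  simp_rw [hiff]
  exact hbij.existsUnique z

/-- The solution operator `R = ι (ω ι† ι + τ A)⁻¹ ι†` on `H` is nonnegative with
`‖R‖ ≤ 1 / ω`. -/
theorem IsEllipticOperator.exists_resolvent (hA : IsEllipticOperator A β₀ β₁) (hβ : 0 < β₀)
    (ι : V →L[ℂ] H) (hω : 0 < ω) (hτ : 0 < τ) :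
    ∃ R : H →L[ℂ] H, 0 ≤ R ∧ ‖R‖ * ω ≤ 1 ∧ ∀ (x : V) (h : H),
      (∀ w : V, ω * inner ℂ (ι w) (ι x) + τ * A x w = inner ℂ (ι w) h) → ι x = R h := by
  obtain ⟨u, hu⟩ := hA.isUnit_shiftedOperator (ι := ι) hβ hω.le hτ
  set S : V →L[ℂ] V := ((u⁻¹ : (V →L[ℂ] V)ˣ) : V →L[ℂ] V) with hS
  set B := shiftedOperator ι A ω τ with hB
  have hBS : ∀ z, B (S z) = z := fun z => by
    rw [← hu, hS, ← mul_apply_eq_comp, Units.mul_inv, one_apply_eq_self]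
  have hSB : ∀ z, S (B z) = z := fun z => by
    rw [← hu, hS, ← mul_apply_eq_comp, Units.inv_mul, one_apply_eq_self]
  have hsymm : ∀ x w, inner ℂ (B x) w = inner ℂ x (B w) := fun x w => by
    rw [inner_shiftedOperator_left, hA.inner_shiftedOperator_right]
  set R : H →L[ℂ] H := ι ∘L S ∘L ContinuousLinearMap.adjoint ι with hR
  -- Pairings with `R` become pairings with the symmetric coercive `B`. Coercivity gives `ω ‖R h‖² ≤
  -- Re ⟨R h, h⟩`, hence both positivity and, by Cauchy–Schwarz, the norm bound.
  have hR1 : ∀ h h' : H, inner ℂ (R h) h' = inner ℂ (S (ContinuousLinearMap.adjoint ι h))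
      (B (S (ContinuousLinearMap.adjoint ι h'))) := fun h h' => by
    rw [hBS, ContinuousLinearMap.adjoint_inner_right]; rfl
  have hre : ∀ h, ω * ‖R h‖ ^ 2 ≤ (inner ℂ (R h) h).re := fun h => by
    rw [hR1]
    refine le_trans ?_ (hA.re_inner_shiftedOperator hτ.le _)
    have : 0 ≤ τ * (β₀ * ‖S (ContinuousLinearMap.adjoint ι h)‖ ^ 2) := by positivity
    change ω * ‖ι (S (ContinuousLinearMap.adjoint ι h))‖ ^ 2 ≤ _
    linarith
  refine ⟨R, ?_, ?_, fun x h hx => ?_⟩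
  · rw [ContinuousLinearMap.nonneg_iff_isPositive, ContinuousLinearMap.isPositive_def]
    refine ⟨fun h h' => ?_, fun h => le_trans (by positivity) (hre h)⟩
    change inner ℂ (R h) h' = inner ℂ h (R h')
    rw [hR1, ← hsymm, ← inner_conj_symm, ← hR1, inner_conj_symm]
  · rw [← le_div_iff₀ hω]
    refine R.opNorm_le_bound (by positivity) fun h => ?_
    rw [div_mul_eq_mul_div, one_mul, le_div_iff₀ hω]
    rcases (norm_nonneg (R h)).eq_or_lt with h0 | h0
    · rw [← h0, zero_mul]; exact norm_nonneg h
    · have := (hre h).trans ((Complex.re_le_norm _).trans (norm_inner_le_norm (R h) h))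
      nlinarith
  · have : B x = ContinuousLinearMap.adjoint ι h := ext_inner_left ℂ fun w => by
      rw [hA.inner_shiftedOperator_right, hx, ContinuousLinearMap.adjoint_inner_right]
    rw [hR, ContinuousLinearMap.comp_apply, ContinuousLinearMap.comp_apply, ← this, hSB]

end LaxMilgram

end

/-! ### The BDF equation: differences and time marching -/

section

variable {H V : Type*} [NormedAddCommGroup H] [InnerProductSpace ℂ H]
  [NormedAddCommGroup V] [InnerProductSpace ℂ V]
  {k N : ℕ} {T : ℝ} {ι : V →L[ℂ] H} {A : V →L[ℂ] AntiDual V} {β₀ β₁ : ℝ} {f : ℝ → AntiDual V}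
  {v : H}

theorem bdfDiff_eq_add (k : ℕ) (τ : ℝ) (U : ℤ → H) (n : ℤ) :
    bdfDiff k τ U n = (1 / τ) • (bdfWeight k 0 • U n
      + ∑ j ∈ Finset.range k, bdfWeight k (j + 1) • U (n - (j + 1))) := by
  rw [bdfDiff, Finset.sum_range_succ', add_comm]
  simp

theorem bdfDiff_sub (k : ℕ) (τ : ℝ) (U U' : ℤ → H) (n : ℤ) :
    bdfDiff k τ (fun i => U i - U' i) n = bdfDiff k τ U n - bdfDiff k τ U' n := by
  simp only [bdfDiff, smul_sub, Finset.sum_sub_distrib]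

theorem inner_real_smul_right (c : ℝ) (x y : H) : inner ℂ x (c • y) = c * inner ℂ x y := by
  rw [← Complex.coe_smul, inner_smul_right]

theorem BDFEquation.congr {U U' : ℤ → H} {n : ℕ} (h : BDFEquation k N T ι A f v U n)
    (hU : ∀ i : ℤ, i ≤ n → U' i = U i) : BDFEquation k N T ι A f v U' n := by
  have e : bdfDiff k (T / N) U' n = bdfDiff k (T / N) U n := by
    simp only [bdfDiff]
    congr 1
    exact Finset.sum_congr rfl fun j _ => by rw [hU _ (by omega)]
  unfold BDFEquation at h ⊢
  rwa [e, hU n le_rfl]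

/-- The difference of two solutions of the BDF equation solves the homogeneous equation. -/
theorem BDFEquation.exists_sub {τ : ℝ} (hτ : τ ≠ 0) (hτN : T / N = τ) {U U' : ℤ → H} {n : ℕ}
    (h : BDFEquation k N T ι A f v U n) (h' : BDFEquation k N T ι A f v U' n) :
    ∃ x : V, ι x = U n - U' n ∧ ∀ w : V,
      bdfWeight k 0 * inner ℂ (ι w) (ι x) + τ * A x w = inner ℂ (ι w)
        (-∑ j ∈ Finset.range k, bdfWeight k (j + 1) • (U (n - (j + 1)) - U' (n - (j + 1)))) := by
  obtain ⟨x, hx, hxw⟩ := h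
  obtain ⟨x', hx', hxw'⟩ := h'
  -- The corrections `a_n v` cancel, so the difference lies in `V` even when `v` does not.
  have hιx : ι (x - x') = U n - U' n := by rw [map_sub, hx, hx']; abel
  refine ⟨x - x', hιx, fun w => ?_⟩
  have e : inner ℂ (ι w) (bdfDiff k τ (fun i => U i - U' i) n) + A (x - x') w = 0 := by
    rw [bdfDiff_sub, inner_sub_right, map_sub, sub_apply, ← hτN]
    linear_combination hxw w - hxw' w
  rw [bdfDiff_eq_add, inner_real_smul_right, inner_add_right, inner_real_smul_right] at e
  rw [inner_neg_right, hιx]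
  have hτc : (τ : ℂ) ≠ 0 := by exact_mod_cast hτ
  push_cast at e
  field_simp at e
  linear_combination e

variable [CompleteSpace H] [CompleteSpace V]

theorem IsEllipticOperator.exists_bdfEquation_update (hA : IsEllipticOperator A β₀ β₁)
    (hβ : 0 < β₀) (hk : 1 ≤ k) (hT : 0 < T) (hN : 1 ≤ N) (U : ℤ → H) (n : ℕ) :
    ∃ z : H, BDFEquation k N T ι A f v (Function.update U n z) n := by
  have hτ : 0 < T / N := div_pos hT (by exact_mod_cast hN)
  set τ := T / N with hτdef
  set s := ∑ j ∈ Finset.range k, bdfWeight k (j + 1) • U (n - (j + 1)) with hs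
  -- The unknown is `x = Uⁿ + a_n v`, so `ω₀ a_n v` moves to the right-hand side.
  obtain ⟨x, hx, -⟩ := hA.existsUnique (ι := ι) hβ (bdfWeight_zero_pos hk).le hτ
    ((τ : ℂ) • bdfSource k N T f n
      - (innerSLFlip ℂ (s - bdfWeight k 0 • bdfA k n • v)).comp ι)
  refine ⟨ι x - bdfA k n • v, x, by simp, fun w => ?_⟩
  have e : ∑ j ∈ Finset.range k,
      bdfWeight k (j + 1) • Function.update U n (ι x - bdfA k n • v) (n - (j + 1)) = s :=
    Finset.sum_congr rfl fun j _ => by rw [Function.update_of_ne (by omega)]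
  rw [← hτdef, bdfDiff_eq_add, e, Function.update_self, inner_real_smul_right]
  have hxw := hx w
  simp only [sub_apply, smul_apply, ContinuousLinearMap.comp_apply,
    innerSLFlip_apply_apply, inner_sub_right, inner_real_smul_right] at hxw
  have hτc : (τ : ℂ) ≠ 0 := by exact_mod_cast hτ.ne'
  simp only [inner_add_right, inner_sub_right, inner_real_smul_right, smul_eq_mul] at hxw ⊢
  push_cast
  field_simp
  linear_combination hxw

theorem IsEllipticOperator.exists_bdf_solution (hA : IsEllipticOperator A β₀ β₁)
    (hβ : 0 < β₀) (hk : 1 ≤ k) (hT : 0 < T) (hN : 1 ≤ N) (ι : V →L[ℂ] H) (f : ℝ → AntiDual V)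
    (v : H) (u : ℕ → H) (M : ℕ) :
    ∃ U : ℤ → H, (∀ j : ℕ, U (-(j : ℤ)) = u j) ∧
      ∀ n : ℕ, 1 ≤ n → n ≤ M → BDFEquation k N T ι A f v U n := by
  induction M with
  | zero => exact ⟨fun i => u (-i).toNat, fun j => by simp, fun n h1 h2 => by omega⟩
  | succ M ih =>
    obtain ⟨U, hU, hE⟩ := ih
    obtain ⟨z, hz⟩ := hA.exists_bdfEquation_update (ι := ι) (f := f) (v := v) hβ hk hT hN U (M + 1)
    refine ⟨Function.update U ((M + 1 : ℕ) : ℤ) z, fun j => ?_, fun n h1 h2 => ?_⟩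
    · rw [Function.update_of_ne (by omega), hU]
    · rcases Nat.le_succ_iff.1 h2 with h | rfl
      · exact (hE n h1 h).congr fun i hi => Function.update_of_ne (by omega) _ _
      · exact hz

end

/-! ### Stability and the iteration -/

/-- Stability of BDF`k`, `k ≤ 6`: the difference of two solutions with the same data is bounded by
the difference of the starting values in `H`, with a constant that depends only on `k`. -/
theorem exists_bdf_stability {k : ℕ} (hk1 : 1 ≤ k) (hk6 : k ≤ 6) :
    ∃ K : ℝ, 0 ≤ K ∧ ∀ (H V : Type*) [NormedAddCommGroup H] [InnerProductSpace ℂ H]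
      [CompleteSpace H] [NormedAddCommGroup V] [InnerProductSpace ℂ V] [CompleteSpace V]
      (T : ℝ) (ι : V →L[ℂ] H) (A : V →L[ℂ] AntiDual V) (β₀ β₁ : ℝ) (f : ℝ → AntiDual V) (v : H)
      (N : ℕ), 0 < T → 0 < β₀ → 1 ≤ N → IsEllipticOperator A β₀ β₁ → ∀ U U' : ℤ → H,
      (∀ n : ℕ, 1 ≤ n → n ≤ N → BDFEquation k N T ι A f v U n) →
      (∀ n : ℕ, 1 ≤ n → n ≤ N → BDFEquation k N T ι A f v U' n) →
      ∀ n : ℤ, 1 - (k : ℤ) ≤ n → n ≤ N →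
        ‖U n - U' n‖ ≤ K * ∑ j ∈ Finset.range k, ‖U (-(j : ℤ)) - U' (-(j : ℤ))‖ := by
  obtain ⟨K, hK0, hK⟩ := exists_norm_le_of_bdf_operator hk1 hk6
  refine ⟨K, hK0, fun H V _ _ _ _ _ _ T ι A β₀ β₁ f v N hT hβ hN hA U U' hU hU' n hn1 hnN => ?_⟩
  have hτ : 0 < T / N := div_pos hT (by exact_mod_cast hN)
  obtain ⟨R, hR0, hR1, hR⟩ := hA.exists_resolvent hβ ι (bdfWeight_zero_pos hk1) hτ
  -- Shifted so that indices `0, …, k - 1` are the starting levels `1 - k, …, 0`.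
  obtain ⟨y, hy⟩ : ∃ y : ℕ → H, ∀ m : ℕ, y m = U (m + 1 - k) - U' (m + 1 - k) := ⟨_, fun _ => rfl⟩
  obtain ⟨m, rfl⟩ : ∃ m : ℕ, n = m + 1 - k := ⟨(n + k - 1).toNat, by omega⟩
  have key := hK H R hR0 hR1 y N (fun m hm => ?_) m (by omega)
  · rw [← hy]
    refine key.trans_eq ?_
    rw [← Finset.sum_range_reflect]
    congr 1
    refine Finset.sum_congr rfl fun j hj => ?_
    rw [Finset.mem_range] at hj
    rw [hy, show ((k - 1 - j : ℕ) : ℤ) + 1 - k = -(j : ℤ) by omega]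
  · obtain ⟨x, hx, hxw⟩ := (hU (m + 1) (by omega) (by omega)).exists_sub hτ.ne' rfl
      (hU' (m + 1) (by omega) (by omega))
    have e : y (m + k) = ι x := by
      rw [hx, hy, show ((m + k : ℕ) : ℤ) + 1 - k = ((m + 1 : ℕ) : ℤ) by omega]
    rw [e, hR x _ hxw, map_neg, sum_fin_bdfWeight k fun j i => bdfWeight k j • y (m + i)]
    congr 2
    refine Finset.sum_congr rfl fun j hj => ?_
    rw [Finset.mem_range] at hj
    rw [hy, show ((m + (k - (j + 1)) : ℕ) : ℤ) + 1 - k = ((m + 1 : ℕ) : ℤ) - (j + 1) by omega]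

/-- The sum of the norms over the last `k` time levels. -/
theorem sum_norm_le_of_forall_norm_le {H : Type*} [NormedAddCommGroup H] {k N : ℕ} (hN : 1 ≤ N)
    {K S : ℝ} {e : ℤ → H} (h : ∀ n : ℤ, 1 - (k : ℤ) ≤ n → n ≤ N → ‖e n‖ ≤ K * S) :
    ∑ j ∈ Finset.range k, ‖e ((N : ℤ) - j)‖ ≤ k * K * S := by
  refine (Finset.sum_le_card_nsmul _ _ (K * S) fun j hj => ?_).trans_eq ?_
  · rw [Finset.mem_range] at hj
    exact h _ (by omega) (by omega)
  · rw [Finset.card_range, nsmul_eq_mul, mul_assoc]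

/-- With `X` the new and `Y` the old error, the triangle inequality gives `X ≤ κ L (X + Y) ≤ (X + Y)
/ 4`, so `X ≤ Y / 3`. -/
theorem sum_norm_le_half_of_iterate {H : Type*} [NormedAddCommGroup H] [NormedSpace ℝ H] {k N : ℕ}
    {κ L : ℝ} (hκ : 0 ≤ κ) (hL : 0 ≤ L) (hκL : κ * L ≤ 1 / 4) {v : H} {U Up W : ℤ → H}
    (hstab : ∑ j ∈ Finset.range k, ‖U ((N : ℤ) - j) - W ((N : ℤ) - j)‖
      ≤ L * ∑ j ∈ Finset.range k, ‖U (-(j : ℤ)) - W (-(j : ℤ))‖)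
    (hU : ∀ j : ℕ, j < k → U (-(j : ℤ)) = v)
    (hW : ∀ j : ℕ, j < k → W (-(j : ℤ)) = v + κ • (W ((N : ℤ) - j) - Up ((N : ℤ) - j))) :
    ∑ j ∈ Finset.range k, ‖U ((N : ℤ) - j) - W ((N : ℤ) - j)‖ ≤
      1 / 2 * ∑ j ∈ Finset.range k, ‖U ((N : ℤ) - j) - Up ((N : ℤ) - j)‖ := by
  have h0 : ∑ j ∈ Finset.range k, ‖U (-(j : ℤ)) - W (-(j : ℤ))‖
      ≤ κ * (∑ j ∈ Finset.range k, ‖U ((N : ℤ) - j) - W ((N : ℤ) - j)‖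
        + ∑ j ∈ Finset.range k, ‖U ((N : ℤ) - j) - Up ((N : ℤ) - j)‖) := by
    rw [← Finset.sum_add_distrib, Finset.mul_sum]
    refine Finset.sum_le_sum fun j hj => ?_
    rw [Finset.mem_range] at hj
    rw [hU j hj, hW j hj, sub_add_cancel_left, norm_neg, norm_smul, Real.norm_of_nonneg hκ]
    refine mul_le_mul_of_nonneg_left ?_ hκ
    rw [← norm_neg (U ((N : ℤ) - j) - W ((N : ℤ) - j)), ← sub_add_sub_cancel (W ((N : ℤ) - j))
      (U ((N : ℤ) - j)), neg_sub]
    exact norm_add_le _ _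
  set X := ∑ j ∈ Finset.range k, ‖U ((N : ℤ) - j) - W ((N : ℤ) - j)‖
  set Y := ∑ j ∈ Finset.range k, ‖U ((N : ℤ) - j) - Up ((N : ℤ) - j)‖
  have hX : 0 ≤ X := Finset.sum_nonneg fun _ _ => norm_nonneg _
  have hY : 0 ≤ Y := Finset.sum_nonneg fun _ _ => norm_nonneg _
  have h1 := hstab.trans (mul_le_mul_of_nonneg_left h0 hL)
  have h2 : κ * L * (X + Y) ≤ 1 / 4 * (X + Y) := mul_le_mul_of_nonneg_right hκL (by positivity)
  linarith

/-- A step of the iteration has a solution if `κ` is small compared to the stability constant. -/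
theorem exists_isBDFIterate {H V : Type*} [NormedAddCommGroup H] [InnerProductSpace ℂ H]
    [CompleteSpace H] [NormedAddCommGroup V] [InnerProductSpace ℂ V] [CompleteSpace V]
    {k N : ℕ} {T β₀ β₁ κ K : ℝ} {ι : V →L[ℂ] H} {A : V →L[ℂ] AntiDual V} {f : ℝ → AntiDual V}
    {v : H} (hA : IsEllipticOperator A β₀ β₁) (hβ : 0 < β₀) (hk : 1 ≤ k) (hT : 0 < T) (hN : 1 ≤ N)
    (hκ : 0 ≤ κ) (hK : 0 ≤ K) (hκK : κ * (k * K) ≤ 1 / 4)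
    (hstab : ∀ U U' : ℤ → H, (∀ n : ℕ, 1 ≤ n → n ≤ N → BDFEquation k N T ι A f v U n) →
      (∀ n : ℕ, 1 ≤ n → n ≤ N → BDFEquation k N T ι A f v U' n) →
      ∀ n : ℤ, 1 - (k : ℤ) ≤ n → n ≤ N →
        ‖U n - U' n‖ ≤ K * ∑ j ∈ Finset.range k, ‖U (-(j : ℤ)) - U' (-(j : ℤ))‖)
    (Uprev : ℤ → H) : ∃ U : ℤ → H, IsBDFIterate k N T κ ι A f v Uprev U := by
  have hsol : ∀ u : Fin k → H, ∃ U : ℤ → H, (∀ j : Fin k, U (-((j : ℕ) : ℤ)) = u j) ∧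
      ∀ n : ℕ, 1 ≤ n → n ≤ N → BDFEquation k N T ι A f v U n := by
    intro u
    obtain ⟨U, hU, hE⟩ := hA.exists_bdf_solution hβ hk hT hN ι f v
      (fun j => if h : j < k then u ⟨j, h⟩ else 0) N
    exact ⟨U, fun j => by simp [hU], hE⟩
  choose sol hsol0 hsolE using hsol
  -- `F` sends starting values to those prescribed by the resulting solution; a fixed point is an
  -- iterate. In the sup norm its Lipschitz constant is at most `κ k K ≤ 1/4`.
  set F : (Fin k → H) → Fin k → H := fun u j =>
    v + κ • (sol u ((N : ℤ) - (j : ℕ)) - Uprev ((N : ℤ) - (j : ℕ))) with hF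
  have hcontr : ContractingWith (1 / 4) F := by
    refine ⟨by rw [← NNReal.coe_lt_coe]; norm_num, LipschitzWith.of_dist_le_mul fun u u' => ?_⟩
    rw [dist_eq_norm, dist_eq_norm, pi_norm_le_iff_of_nonneg (by positivity)]
    intro j
    have h1 := hstab _ _ (hsolE u) (hsolE u') ((N : ℤ) - (j : ℕ)) (by omega) (by omega)
    have h2 : ∑ j ∈ Finset.range k, ‖sol u (-(j : ℤ)) - sol u' (-(j : ℤ))‖ ≤ k * ‖u - u'‖ := by
      rw [Finset.sum_range]
      refine (Finset.sum_le_card_nsmul _ _ ‖u - u'‖ fun i _ => ?_).trans_eq (by simp)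
      rw [hsol0, hsol0]
      exact norm_le_pi_norm (u - u') i
    rw [Pi.sub_apply, hF]
    simp only [add_sub_add_left_eq_sub, ← smul_sub, sub_sub_sub_cancel_right]
    rw [norm_smul, Real.norm_of_nonneg hκ]
    calc κ * ‖sol u ((N : ℤ) - (j : ℕ)) - sol u' ((N : ℤ) - (j : ℕ))‖
        ≤ κ * (K * (k * ‖u - u'‖)) := by gcongr; exact h1.trans (by gcongr)
      _ = κ * (k * K) * ‖u - u'‖ := by ring
      _ ≤ 1 / 4 * ‖u - u'‖ := by gcongr
      _ = _ := by norm_num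
  set u := ContractingWith.fixedPoint F hcontr with hu
  have hfix : F u = u := hcontr.fixedPoint_isFixedPt
  refine ⟨sol u, fun j hj => ?_, hsolE u⟩
  rw [hsol0 u ⟨j, hj⟩]
  conv_lhs => rw [← hfix]

theorem corollary2p6 (k : ℕ) (hk1 : 1 ≤ k) (hk6 : k ≤ 6) (T β₀ : ℝ) (hT : 0 < T) (hβ₀ : 0 < β₀) :
    ∃ κ γ : ℝ, 0 < κ ∧ 0 < γ ∧ γ < 1 ∧
      ∀ (H V : Type*) [NormedAddCommGroup H] [InnerProductSpace ℂ H] [CompleteSpace H]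
        [NormedAddCommGroup V] [InnerProductSpace ℂ V] [CompleteSpace V]
        (ι : V →L[ℂ] H) (A : V →L[ℂ] AntiDual V) (β₁ : ℝ)
        (f : ℝ → AntiDual V) (v : H) (N : ℕ),
        IsGelfandEmbedding ι → β₀ < β₁ → IsEllipticOperator A β₀ β₁ →
        ContDiffOn ℝ ((k - 2 : ℕ) : WithTop ℕ∞) f (Set.Icc 0 T) → 1 ≤ N →
        -- the scheme is uniquely solvable
        (∃ U : ℤ → H, IsBDFSolution k N T ι A f v U ∧
          ∀ U' : ℤ → H, IsBDFSolution k N T ι A f v U' →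
            ∀ n : ℤ, 1 - (k : ℤ) ≤ n → n ≤ N → U' n = U n) ∧
        -- each step of the iteration is uniquely solvable
        (∀ Uprev : ℤ → H, ∃ U : ℤ → H, IsBDFIterate k N T κ ι A f v Uprev U ∧
          ∀ U' : ℤ → H, IsBDFIterate k N T κ ι A f v Uprev U' →
            ∀ n : ℤ, 1 - (k : ℤ) ≤ n → n ≤ N → U' n = U n) ∧
        -- contraction of the error over the last `k` time levels
        (∀ (U : ℤ → H) (Um : ℕ → ℤ → H), IsBDFSolution k N T ι A f v U →
          (∀ m : ℕ, 1 ≤ m → IsBDFIterate k N T κ ι A f v (Um (m - 1)) (Um m)) →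
          ∀ m : ℕ, 1 ≤ m →
            ∑ j ∈ Finset.range k, ‖U ((N : ℤ) - j) - Um m ((N : ℤ) - j)‖ ≤
              γ * ∑ j ∈ Finset.range k, ‖U ((N : ℤ) - j) - Um (m - 1) ((N : ℤ) - j)‖) := by
  obtain ⟨K, hK0, hK⟩ := exists_bdf_stability hk1 hk6
  have hL : 0 ≤ k * K := by positivity
  -- The `+ 1` keeps `κ` positive even if `K = 0`.
  have hκ : 0 < 1 / (4 * (k * K + 1)) := by positivity
  have hκL : 1 / (4 * (k * K + 1)) * (k * K) ≤ 1 / 4 := by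
    rw [div_mul_eq_mul_div, one_mul, div_le_iff₀ (by positivity)]
    linarith
  refine ⟨1 / (4 * (k * K + 1)), 1 / 2, hκ, by norm_num, by norm_num, ?_⟩
  generalize 1 / (4 * (k * K + 1)) = κ at hκ hκL
  intro H V _ _ _ _ _ _ ι A β₁ f v N _ _ hA _ hN
  have hstab := hK H V T ι A β₀ β₁ f v N hT hβ₀ hN hA
  refine ⟨?_, fun Uprev => ?_, fun U Um hU hUm m hm => ?_⟩
  · obtain ⟨U, hU, hE⟩ := hA.exists_bdf_solution hβ₀ hk1 hT hN ι f v (fun _ => v) N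
    refine ⟨U, ⟨fun j _ => hU j, hE⟩, fun U' hU' n hn1 hnN => ?_⟩
    have h := hstab U' U hU'.equation hE n hn1 hnN
    rw [Finset.sum_eq_zero fun j hj => ?_, mul_zero] at h
    · exact sub_eq_zero.1 (norm_le_zero_iff.1 h)
    · rw [hU'.initial j (Finset.mem_range.1 hj), hU, sub_self, norm_zero]
  · obtain ⟨U, hU⟩ := exists_isBDFIterate hA hβ₀ hk1 hT hN hκ.le hK0 hκL hstab Uprev
    refine ⟨U, hU, fun U' hU' n hn1 hnN => ?_⟩
    have h := hstab U' U hU'.equation hU.equation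
    set S := ∑ j ∈ Finset.range k, ‖U' (-(j : ℤ)) - U (-(j : ℤ))‖ with hS
    have hSle : S ≤ κ * ∑ j ∈ Finset.range k, ‖U' ((N : ℤ) - j) - U ((N : ℤ) - j)‖ := by
      rw [hS, Finset.mul_sum]
      refine Finset.sum_le_sum fun j hj => ?_
      rw [Finset.mem_range] at hj
      rw [hU'.initial j hj, hU.initial j hj, add_sub_add_left_eq_sub, ← smul_sub,
        sub_sub_sub_cancel_right, norm_smul, Real.norm_of_nonneg hκ.le]
    have hS0 : 0 ≤ S := Finset.sum_nonneg fun _ _ => norm_nonneg _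
    have hS1 := hSle.trans (mul_le_mul_of_nonneg_left
      (sum_norm_le_of_forall_norm_le (e := fun i => U' i - U i) hN h) hκ.le)
    -- The coupling and stability give `S ≤ κ k K S ≤ S / 4`.
    have hSz : S = 0 := by nlinarith
    have hn := h n hn1 hnN
    rw [hSz, mul_zero] at hn
    exact sub_eq_zero.1 (norm_le_zero_iff.1 hn)
  · exact sum_norm_le_half_of_iterate hκ.le hL hκL
      (sum_norm_le_of_forall_norm_le (e := fun i => U i - Um m i) hN
        (hstab U (Um m) hU.equation (hUm m hm).equation))
      hU.initial (hUm m hm).initial
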